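/- Let $K\ge 1$, let $\mathbb F_q$ be the finite field with $q$ elements, and assume that $q\ge 3$ or $K\le 2$. Let $0\le\rho\le 1$. Consider the $K$-user interference channel over $\mathbb F_q$ with fast fading: at each time $t=1,\dots,n$ receiver $k$ observes $$Y_k(t)=\sum_{\ell=1}^K h_{k\ell}(t)X_\ell(t)+Z_k(t)\in\mathbb F_q ,$$ where the coefficients $h_{k\ell}(t)$ are independent and uniform on $\mathbb F_q\setminus\{0\}$ over all $k,\ell,t$, and the noise symbols $Z_k(t)$ are independent over all $k,t$, equal to $0$ with probability $1-\rho$ and to each non-zero element of $\mathbb F_q$ with probability $\rho/(q-1)$. User $k$ has a message $w_k$ that is uniform on a set of $M_k\ge 1$ elements; messages, coefficients and noise are independent. The input $X_k(t)$ is a function of $w_k$ and of the channel matrices $\mathbf H(1),\dots,\mathbf H(t)$, where $\mathbf H(s)=(h_{k\ell}(s))_{k,\ell}$; receiver $k$ forms an estimate $\hat w_k$ of $w_k$ from $Y_k(1),\dots,Y_k(n)$ and $\mathbf H(1),\dots,\mathbf H(n)$. The rate of user $k$ is $\tilde R_k=\frac1n\log_2 M_k$. A rate tuple $(R_1,\dots,R_K)$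 is achievable if for every $\epsilon>0$ and all sufficiently large $n$ there are such encoding and decoding functions with $\tilde R_k>R_k-\epsilon$ for all $k$ and $\Pr(\hat w_k\ne w_k\text{ for some }k)<\epsilon$. Then the symmetric rate tuple $(R_{\mathrm{SYM}},\dots,R_{\mathrm{SYM}})$ with $$R_{\mathrm{SYM}}=\tfrac12\bigl(\log_2 q-H(Z)\bigr)$$ is achievable, where $H(Z)=-\sum_{z\in\mathbb F_q}\Pr(Z=z)\log_2\Pr(Z=z)$ is the entropy of a noise symbol in bits. -/

import Mathlib

namespace ErgodicIC

/-- The channel matrices of the `K`-user network over `F`: all coefficients are non-zero. The entry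
`H k l` is the coefficient from transmitter `l` to receiver `k`. -/
abbrev ChannelMatrix (F : Type*) [Field F] (K : ℕ) : Type _ :=
  Fin K → Fin K → Fˣ

/-- The law of one noise symbol: zero with probability `1 - ρ`, and with probability `ρ` uniform on
the `q - 1` non-zero elements of `F`. -/
noncomputable def noiseProb (F : Type*) [Field F] [Fintype F] [DecidableEq F] (ρ : ℝ) (z : F) : ℝ :=
  if z = 0 then 1 - ρ else ρ / ((Fintype.card F : ℝ) - 1)

/-- Shannon entropy, in bits, of a probability mass function on a finite type. -/
noncomputable def entropyBits {α : Type*} [Fintype α] (p : α → ℝ) : ℝ :=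
  -∑ a, p a * Real.logb 2 (p a)

/-- A code for `n` uses of the `K`-user interference channel with fading. User `k` has `size k`
messages. The symbol that a transmitter sends at time `t` is a function of its own message and of
the channel matrices up to and including time `t`. A receiver decodes from its `n` outputs and the
sequence of channel matrices. -/
structure Code (F : Type*) [Field F] (K n : ℕ) where
  size : Fin K → ℕ
  size_pos : ∀ k, 0 < size k
  enc : (k : Fin K) → Fin (size k) → (Fin n → ChannelMatrix F K) → Fin n → F
  enc_causal : ∀ (k : Fin K) (w : Fin (size k)) (H H' : Fin n → ChannelMatrix F K) (t : Fin n),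
    (∀ s, s ≤ t → H s = H' s) → enc k w H t = enc k w H' t
  dec : (k : Fin K) → (Fin n → F) → (Fin n → ChannelMatrix F K) → Fin (size k)

namespace Code

/-- The rate of user `k` in bits per channel use. -/
noncomputable def rate {F : Type*} [Field F] {K n : ℕ} (c : Code F K n) (k : Fin K) : ℝ :=
  Real.logb 2 (c.size k) / n

/-- The output of receiver `k` at time `t` for the messages `w`, channel matrices `H` and
noise `Z`. -/
def output {F : Type*} [Field F] {K n : ℕ} (c : Code F K n) (w : (k : Fin K) → Fin (c.size k))
    (H : Fin n → ChannelMatrix F K) (Z : Fin n → Fin K → F) (k : Fin K) (t : Fin n) : F :=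
  ∑ l, (H t k l : F) * c.enc l (w l) H t + Z t k

/-- Some receiver fails to recover its message. -/
def Fails {F : Type*} [Field F] {K n : ℕ} (c : Code F K n) (w : (k : Fin K) → Fin (c.size k))
    (H : Fin n → ChannelMatrix F K) (Z : Fin n → Fin K → F) : Prop :=
  ∃ k, c.dec k (c.output w H Z k) H ≠ w k

open Classical in
/-- The probability that some receiver fails, when the messages are independent and uniform, the
channel coefficients are independent and uniform on `F \ {0}` over all times and pairs of users,
the noise symbols are independent over all times and receivers with law `noiseProb F ρ`, and
messages, coefficients and noise are independent of each other. -/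
noncomputable def errorProb {F : Type*} [Field F] [Fintype F] [DecidableEq F] {K n : ℕ}
    (c : Code F K n) (ρ : ℝ) : ℝ :=
  ∑ w : (k : Fin K) → Fin (c.size k), ∑ H : Fin n → ChannelMatrix F K, ∑ Z : Fin n → Fin K → F,
    (∏ k, (1 / (c.size k : ℝ))) *
      (∏ _t : Fin n, ∏ _k : Fin K, ∏ _l : Fin K, (1 / (Fintype.card Fˣ : ℝ))) *
      (∏ t, ∏ k, noiseProb F ρ (Z t k)) *
      (if c.Fails w H Z then 1 else 0)

end Code

/-- The rate tuple `R` is achievable on the `K`-user interference channel over `F` with noise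
parameter `ρ`. -/
def Achievable (F : Type*) [Field F] [Fintype F] [DecidableEq F] (K : ℕ) (ρ : ℝ)
    (R : Fin K → ℝ) : Prop :=
  ∀ ε : ℝ, 0 < ε → ∃ N : ℕ, ∀ n : ℕ, N ≤ n →
    ∃ c : Code F K n, (∀ k, R k - ε < c.rate k) ∧ c.errorProb ρ < ε

end ErgodicIC

/-! Suppose a channel state `A` is matched with a state that has the same off-diagonal entries and
whose diagonal is multiplied by some u ≠ 1. If all users send the same symbols in both states, the
interference is the same both times and the difference at receiver k is (1 - u) `A k k` times the
wanted symbol. Such a unit u exists once q ≥ 3; for K ≤ 2, giving each user its own half of the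
block serves the same purpose. `Alignment` covers both cases.

Subtracting the raw outputs would add two noises. Instead all users share one linear code, so what a
receiver hears in one half is a codeword of a linear combination of messages plus a single noise. It
decodes this combination in each half and only then combines the results. Hence the code needs only
rate below log q - H(Z), and the factor 1/2 is the price of using two slots per symbol.

The multiplication by u permutes the states, and every state occurs about n / (2N) times in each
half, where N is the number of states. A separate message block is therefore coded for each `A`, its
j-th symbol being sent at the j-th visit to the matched state in each half; a causal encoder knows
which visit is taking place. The ingredients are random linear codes (`exists_linear_code`),
concentration of the visit counts (`exists_visitsAll_bound`), the coding scheme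
(`Alignment.exists_code`) and a union bound over receivers, halves and states (`errorProb_le`). -/

namespace ErgodicIC

open Finset

/-! ### Independent sequences over a finite alphabet -/

section FiniteProbability

variable {ι α : Type*} [Fintype ι] [DecidableEq ι] [Fintype α] {p : α → ℝ}

theorem sum_prod_eq_one (hp : ∑ a, p a = 1) : ∑ z : ι → α, ∏ i, p (z i) = 1 := by
  classical
  rw [← Fintype.prod_sum (fun (_ : ι) a => p a)]
  simp [hp]

/-- The second moment of a sum of independent centred random variables. -/
theorem sum_prod_mul_sq_sum (hp : ∑ a, p a = 1) (f : ι → α → ℝ)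
    (hf : ∀ i, ∑ a, p a * f i a = 0) :
    ∑ z : ι → α, (∏ i, p (z i)) * (∑ i, f i (z i)) ^ 2 = ∑ i, ∑ a, p a * f i a ^ 2 := by
  classical
  have key : ∀ i j : ι, ∑ z : ι → α, (∏ k, p (z k)) * (f i (z i) * f j (z j)) =
      if i = j then ∑ a, p a * f i a ^ 2 else 0 := by
    intro i j
    -- Padding the two factors with ones gives a product over all coordinates, so the sum over `z`
    -- factorises.
    have h1 : ∀ z : ι → α, (∏ k, p (z k)) * (f i (z i) * f j (z j)) =
        ∏ k, (p (z k) * ((if k = i then f i (z k) else 1) * (if k = j then f j (z k) else 1))) := by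
      intro z
      rw [prod_mul_distrib, prod_mul_distrib]
      simp
    simp_rw [h1]
    rw [← Fintype.prod_sum (fun k a =>
      p a * ((if k = i then f i a else 1) * (if k = j then f j a else 1)))]
    split_ifs with hij
    · subst hij
      rw [prod_eq_single i]
      · simp [sq]
      · intro k _ hk
        simp [hk, hp]
      · simp
    · apply prod_eq_zero (mem_univ i)
      simp [hij, hf]
  simp_rw [sq, sum_mul_sum, mul_sum]
  rw [sum_comm]
  refine sum_congr rfl fun i _ => ?_
  rw [sum_comm]
  simp_rw [key]
  simp [sq]

open Classical in
/-- Chebyshev's inequality for a sum of independent centred random variables. -/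
theorem sum_prod_chebyshev (hp0 : ∀ a, 0 ≤ p a) (hp : ∑ a, p a = 1) (f : ι → α → ℝ)
    (hf : ∀ i, ∑ a, p a * f i a = 0) {c : ℝ} (hc : 0 < c) :
    ∑ z : ι → α, (∏ i, p (z i)) * (if c ≤ |∑ i, f i (z i)| then 1 else 0) ≤
      (∑ i, ∑ a, p a * f i a ^ 2) / c ^ 2 := by
  rw [← sum_prod_mul_sq_sum hp f hf, sum_div]
  refine sum_le_sum fun z _ => ?_
  rw [mul_div_assoc]
  refine mul_le_mul_of_nonneg_left ?_ (prod_nonneg fun i _ => hp0 _)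
  split_ifs with h
  · rw [le_div_iff₀ (by positivity), one_mul, ← sq_abs (∑ i, _)]
    gcongr
  · positivity

/-- The marginal law of the coordinates selected by an injection. -/
theorem sum_prod_mul_comp {κ : Type*} [Fintype κ] [DecidableEq κ] (hp : ∑ a, p a = 1) {τ : κ → ι}
    (hτ : Function.Injective τ) (φ : (κ → α) → ℝ) :
    ∑ Z : ι → α, (∏ i, p (Z i)) * φ (Z ∘ τ) = ∑ z : κ → α, (∏ j, p (z j)) * φ z := by
  classical
  -- Coordinates outside the range of `τ` are summed out to 1; those inside are relabelled by `κ`.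
  let P : ι → Prop := fun i => i ∈ Set.range τ
  let e : κ ≃ {i // P i} := Equiv.ofInjective τ hτ
  rw [← (Equiv.piEquivPiSubtypeProd P (fun _ => α)).symm.sum_comp, Fintype.sum_prod_type,
    ← (Equiv.arrowCongr e (Equiv.refl α)).sum_comp]
  refine sum_congr rfl fun z _ => ?_
  have h1 : ∀ y : {i // ¬ P i} → α,
      (∏ i, p ((Equiv.piEquivPiSubtypeProd P (fun _ => α)).symm
        ((Equiv.arrowCongr e (Equiv.refl α)) z, y) i)) *
      φ ((Equiv.piEquivPiSubtypeProd P (fun _ => α)).symm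
        ((Equiv.arrowCongr e (Equiv.refl α)) z, y) ∘ τ) =
      ((∏ j, p (z j)) * φ z) * ∏ i, p (y i) := by
    intro y
    have h2 : (Equiv.piEquivPiSubtypeProd P (fun _ => α)).symm
        ((Equiv.arrowCongr e (Equiv.refl α)) z, y) ∘ τ = z := by
      funext j
      have hj : P (τ j) := ⟨j, rfl⟩
      have : e.symm ⟨τ j, hj⟩ = j := by
        rw [Equiv.symm_apply_eq]; rfl
      simp [Equiv.piEquivPiSubtypeProd, hj, this]
    rw [h2, ← Fintype.prod_subtype_mul_prod_subtype P]
    have h3 : ∏ i : {i // P i}, p ((Equiv.piEquivPiSubtypeProd P (fun _ => α)).symm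
        ((Equiv.arrowCongr e (Equiv.refl α)) z, y) i) = ∏ j, p (z j) := by
      rw [← e.prod_comp]
      refine prod_congr rfl fun j _ => ?_
      exact congrArg p (congrFun h2 j)
    have h4 : ∏ i : {i // ¬ P i}, p ((Equiv.piEquivPiSubtypeProd P (fun _ => α)).symm
        ((Equiv.arrowCongr e (Equiv.refl α)) z, y) i) = ∏ i, p (y i) := by
      refine prod_congr rfl fun i _ => ?_
      simp [Equiv.piEquivPiSubtypeProd, i.2]
    trans (∏ j, p (z j)) * (∏ i, p (y i)) * φ z
    · refine congrArg₂ (· * ·) (congrArg₂ (· * ·) ?_ h4) rfl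
      convert h3
    · ring
  rw [sum_congr rfl fun y _ => h1 y, ← mul_sum, sum_prod_eq_one hp, mul_one]

/-- The noise that one receiver `k` sees along distinct times is again i.i.d.: after uncurrying, `j
↦ (τ j, k)` is an injection. -/
theorem sum_prod_prod_mul_comp {κ μ : Type*} [Fintype κ] [DecidableEq κ] [Fintype μ]
    [DecidableEq μ] (hp : ∑ a, p a = 1)
    {τ : κ → ι} (hτ : Function.Injective τ) (k : μ) (φ : (κ → α) → ℝ) :
    ∑ Z : ι → μ → α, (∏ i, ∏ k, p (Z i k)) * φ (fun j => Z (τ j) k) =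
      ∑ z : κ → α, (∏ j, p (z j)) * φ z := by
  classical
  have hinj : Function.Injective (fun j : κ => (τ j, k)) := fun a b h =>
    hτ (congrArg Prod.fst h)
  rw [← sum_prod_mul_comp hp hinj φ, ← (Equiv.curry ι μ α).sum_comp]
  refine sum_congr rfl fun Z _ => ?_
  rw [Fintype.prod_prod_type]
  rfl

open Classical in
/-- A typical set: few sequences carry most of the probability. -/
theorem exists_typical_set (hp0 : ∀ a, 0 ≤ p a) (hp : ∑ a, p a = 1) {δ ε : ℝ} (hδ : 0 < δ)
    (hε : 0 < ε) :
    ∃ M : ℕ, ∀ m : ℕ, M ≤ m → ∃ T : Finset (Fin m → α),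
      (T.card : ℝ) ≤ (2 : ℝ) ^ ((m : ℝ) * (entropyBits p + δ)) ∧
      ∑ z : Fin m → α, (∏ i, p (z i)) * (if z ∉ T then 1 else 0) ≤ ε := by
  set h := entropyBits p with hh
  set g : α → ℝ := fun a => -Real.logb 2 (p a) - h with hg
  set V := ∑ a, p a * g a ^ 2 with hV
  have hV0 : 0 ≤ V := sum_nonneg fun a _ => mul_nonneg (hp0 a) (sq_nonneg _)
  have hgc : ∑ a, p a * g a = 0 := by
    simp only [hg, mul_sub, sum_sub_distrib, ← sum_mul, hp, hh, entropyBits]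
    simp
  refine ⟨⌈V / (δ ^ 2 * ε)⌉₊ + 1, fun m hm => ?_⟩
  have hm0 : (0 : ℝ) < m := by exact_mod_cast (by omega : 0 < m)
  have hmV : V / (δ ^ 2 * ε) ≤ m := (Nat.le_ceil _).trans (by exact_mod_cast (by omega))
  set B : ℝ := (2 : ℝ) ^ ((m : ℝ) * (h + δ)) with hB
  have hBpos : 0 < B := by positivity
  -- One-sided typicality suffices: at most `B` sequences can have probability at least `1 / B`.
  refine ⟨univ.filter fun z => 1 ≤ B * ∏ i, p (z i), ?_, ?_⟩
  · rw [card_filter]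
    push_cast
    calc ∑ z : Fin m → α, (if 1 ≤ B * ∏ i, p (z i) then (1 : ℝ) else 0)
        ≤ ∑ z : Fin m → α, B * ∏ i, p (z i) := by
          refine sum_le_sum fun z _ => ?_
          have : 0 ≤ ∏ i, p (z i) := prod_nonneg fun i _ => hp0 _
          split_ifs with h
          · exact h
          · positivity
      _ = B := by rw [← mul_sum, sum_prod_eq_one hp, mul_one]
  · have hmδ : 0 < m * δ := by positivity
    refine le_trans ?_ ((sum_prod_chebyshev (ι := Fin m) hp0 hp (fun _ => g) (fun _ => hgc)
      hmδ).trans ?_)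
    · refine sum_le_sum fun z _ => ?_
      -- The logarithm of the product splits only if all factors are non-zero; null sequences
      -- contribute nothing to the sum.
      rcases (prod_nonneg fun i _ => hp0 (z i) : 0 ≤ ∏ i, p (z i)).eq_or_lt with h0 | h0
      · simp [← h0]
      refine mul_le_mul_of_nonneg_left ?_ h0.le
      by_cases h1 : 1 ≤ B * ∏ i, p (z i)
      · rw [if_neg (by simpa using h1)]
        positivity
      · rw [if_pos (by simpa using h1), if_pos]
        refine le_trans ?_ (le_abs_self _)
        have hne : ∀ i ∈ (univ : Finset (Fin m)), p (z i) ≠ 0 := by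
          rw [← prod_ne_zero_iff]; exact h0.ne'
        have h3 : Real.logb 2 (B * ∏ i, p (z i)) < 0 :=
          Real.logb_neg (by norm_num) (by positivity) (not_le.1 h1)
        rw [Real.logb_mul hBpos.ne' h0.ne', hB, Real.logb_rpow (by norm_num) (by norm_num),
          Real.logb_prod _ _ hne] at h3
        simp only [hg, sum_sub_distrib, sum_neg_distrib, sum_const, card_univ, Fintype.card_fin,
          nsmul_eq_mul]
        linarith
    · rw [sum_const, card_univ, Fintype.card_fin, nsmul_eq_mul, ← hV, div_le_iff₀ (by positivity)]
      rw [div_le_iff₀ (by positivity)] at hmV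
      nlinarith

end FiniteProbability

/-! ### Random linear codes for additive noise -/

section LinearCode

variable {F : Type*} [Field F] [Fintype F] [DecidableEq F]

/-- A uniformly random linear map sends a non-zero vector to a uniform vector. -/
theorem card_combination_mem {r m : ℕ} {v : Fin r → F} (hv : v ≠ 0) (T : Finset (Fin m → F)) :
    #{g : Fin r → Fin m → F | Fintype.linearCombination F g v ∈ T} * Fintype.card (Fin m → F) =
      T.card * Fintype.card (Fin r → Fin m → F) := by
  let L : (Fin r → Fin m → F) →+ (Fin m → F) :=
    { toFun := fun g => Fintype.linearCombination F g v
      map_zero' := by simp [Fintype.linearCombination_apply]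
      map_add' := by
        intro g g'
        simp [Fintype.linearCombination_apply, smul_add, sum_add_distrib] }
  have hL : Function.Surjective L := by
    intro x
    obtain ⟨i, hi⟩ := Function.ne_iff.1 hv
    -- One non-zero coordinate of `v` suffices for surjectivity, after which all fibres have the
    -- same size.
    refine ⟨Pi.single i ((v i)⁻¹ • x), ?_⟩
    change Fintype.linearCombination F _ v = x
    rw [Fintype.linearCombination_apply, sum_eq_single i]
    · have : v i ≠ 0 := hi
      simp [smul_smul, this]
    · intro j _ hj
      simp [hj]
    · simp
  have hfib : ∀ x, #{g | L g = x} = #{g | L g = 0} := fun x =>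
    AddMonoidHom.card_fiber_eq_of_mem_range L (hL x) (hL 0)
  have hcount : ∀ S : Finset (Fin m → F), #{g | L g ∈ S} = S.card * #{g | L g = 0} := by
    intro S
    rw [card_eq_sum_card_fiberwise (f := L) (t := S) (fun g hg => by simpa using hg),
      ← smul_eq_mul, ← sum_const]
    refine sum_congr rfl fun x hx => ?_
    rw [← hfib x, filter_filter]
    congr 1
    ext g
    simp only [mem_filter, mem_univ, true_and, and_iff_right_iff_imp]
    rintro rfl
    exact hx
  have h1 := hcount univ
  simp only [mem_univ, filter_true, card_univ] at h1
  change #{g | L g ∈ T} * _ = _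
  rw [hcount T, h1]
  ring

open Classical in
/-- Random coding with linear codes: some linear code corrects every noise sequence outside an
exceptional set, whose probability is bounded in terms of the size and probability of `T`. -/
theorem exists_linear_code_of_set {m : ℕ} (r : ℕ) (P : (Fin m → F) → ℝ) (hP0 : ∀ z, 0 ≤ P z)
    (hP : ∑ z, P z = 1) (T : Finset (Fin m → F)) :
    ∃ (G : (Fin r → F) →ₗ[F] (Fin m → F)) (D : (Fin m → F) → Fin r → F)
      (B : Finset (Fin m → F)), (∀ w, ∀ z ∉ B, D (G w + z) = w) ∧
      ∑ z, P z * (if z ∈ B then 1 else 0) ≤ ∑ z, P z * (if z ∉ T then 1 else 0) +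
        ((Fintype.card F : ℝ) ^ r - 1) * (T.card / (Fintype.card F : ℝ) ^ m) := by
  set q : ℝ := (Fintype.card F : ℝ) with hq
  have hq0 : 0 < q := by rw [hq]; exact_mod_cast Fintype.card_pos
  let Φ := fun g : Fin r → Fin m → F => Fintype.linearCombination F g
  let N : ℝ := Fintype.card (Fin r → Fin m → F)
  -- A noise sequence is bad if it is atypical or if another codeword explains it by typical noise.
  -- By linearity this does not depend on the message sent.
  let bad := fun g : Fin r → Fin m → F =>
    univ.filter fun z : Fin m → F => z ∉ T ∨ ∃ v, v ≠ 0 ∧ z - Φ g v ∈ T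
  let a := ∑ z, P z * (if z ∉ T then (1 : ℝ) else 0)
  have havg : ∀ v : Fin r → F, v ≠ 0 → ∀ z : Fin m → F,
      ∑ g, (if z - Φ g v ∈ T then (1 : ℝ) else 0) = N * (T.card / q ^ m) := by
    intro v hv z
    have h := card_combination_mem hv (T.image fun x => z - x)
    rw [card_image_of_injective _ (sub_right_injective)] at h
    have h2 : ∀ g, (z - Φ g v ∈ T) ↔ Fintype.linearCombination F g v ∈ T.image fun x => z - x := by
      intro g
      simp only [mem_image, Φ]
      constructor
      · intro hg
        exact ⟨_, hg, by simp⟩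
      · rintro ⟨x, hx, hxg⟩
        rw [← hxg]
        simpa using hx
    simp_rw [h2]
    rw [sum_boole]
    have h3 : (Fintype.card (Fin m → F) : ℝ) = q ^ m := by simp [hq]
    have h4 : (#{g : Fin r → Fin m → F | Fintype.linearCombination F g v ∈
        T.image fun x => z - x} : ℝ) * q ^ m = T.card * N := by
      rw [← h3, ← Nat.cast_mul, h, Nat.cast_mul]
    field_simp
    rw [h4]
    ring
  have hsum : ∑ g, ∑ z, P z * (if z ∈ bad g then (1 : ℝ) else 0) ≤
      ∑ g : Fin r → Fin m → F, (a + (q ^ r - 1) * (T.card / q ^ m)) := by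
    calc ∑ g, ∑ z, P z * (if z ∈ bad g then (1 : ℝ) else 0)
        ≤ ∑ g, (a + ∑ v ∈ univ.filter (fun v : Fin r → F => v ≠ 0),
            ∑ z, P z * (if z - Φ g v ∈ T then (1 : ℝ) else 0)) := by
          refine sum_le_sum fun g _ => ?_
          rw [sum_comm, ← sum_add_distrib]
          refine sum_le_sum fun z _ => ?_
          rw [← mul_sum, ← mul_add]
          refine mul_le_mul_of_nonneg_left ?_ (hP0 z)
          have hnn : ∀ v ∈ univ.filter (fun v : Fin r → F => v ≠ 0),
              0 ≤ (if z - Φ g v ∈ T then (1 : ℝ) else 0) := fun v _ => by positivity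
          by_cases hz : z ∈ bad g
          · rw [if_pos hz]
            simp only [bad, mem_filter, mem_univ, true_and] at hz
            rcases hz with hz | ⟨v, hv, hz⟩
            · rw [if_pos hz]
              linarith [sum_nonneg hnn]
            · have := single_le_sum hnn (mem_filter.2 ⟨mem_univ v, hv⟩)
              rw [if_pos hz] at this
              have h0 : 0 ≤ (if z ∉ T then (1 : ℝ) else 0) := by positivity
              linarith
          · rw [if_neg hz]
            have h0 : 0 ≤ (if z ∉ T then (1 : ℝ) else 0) := by positivity
            linarith [sum_nonneg hnn]
      _ = ∑ g : Fin r → Fin m → F, (a + (q ^ r - 1) * (T.card / q ^ m)) := by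
          rw [sum_add_distrib, sum_add_distrib]
          congr 1
          rw [sum_comm, sum_const, card_univ, nsmul_eq_mul]
          have : ∀ v ∈ univ.filter (fun v : Fin r → F => v ≠ 0),
              ∑ g, ∑ z, P z * (if z - Φ g v ∈ T then (1 : ℝ) else 0) =
                N * (T.card / q ^ m) := by
            intro v hv
            rw [sum_comm]
            simp_rw [← mul_sum, havg v (mem_filter.1 hv).2]
            rw [← sum_mul, hP, one_mul]
          rw [sum_congr rfl this, sum_const, nsmul_eq_mul]
          have hc : ((univ.filter (fun v : Fin r → F => v ≠ 0)).card : ℝ) = q ^ r - 1 := by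
            rw [filter_ne' univ (0 : Fin r → F), card_erase_of_mem (mem_univ _), card_univ,
              Nat.cast_sub Fintype.card_pos]
            simp [hq]
          rw [hc]
          ring
  obtain ⟨g, -, hg⟩ := exists_le_of_sum_le univ_nonempty hsum
  -- Any message leaving a residual in `T` may be chosen, because outside `bad g` there is exactly
  -- one.
  refine ⟨Φ g, fun y => if h : ∃ w, y - Φ g w ∈ T then h.choose else 0, bad g, ?_, hg⟩
  intro w z hz
  simp only [bad, mem_filter, mem_univ, true_and, not_or, not_not, not_exists, not_and] at hz
  have hex : ∃ w', Φ g w + z - Φ g w' ∈ T := ⟨w, by simpa using hz.1⟩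
  change (if h : ∃ w', Φ g w + z - Φ g w' ∈ T then h.choose else 0) = w
  rw [dif_pos hex]
  by_contra hne
  apply hz.2 (hex.choose - w) (sub_ne_zero.2 hne)
  have := hex.choose_spec
  rw [map_sub]
  convert this using 1
  abel

open Classical in
/-- Linear codes achieve every rate below the capacity of an additive noise channel. -/
theorem exists_linear_code {p : F → ℝ} (hp0 : ∀ a, 0 ≤ p a) (hp : ∑ a, p a = 1) {R : ℝ}
    (hR0 : 0 ≤ R) (hR : R < Real.logb 2 (Fintype.card F) - entropyBits p) {ε : ℝ} (hε : 0 < ε) :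
    ∃ M : ℕ, ∀ m : ℕ, M ≤ m → ∃ (r : ℕ) (G : (Fin r → F) →ₗ[F] (Fin m → F))
      (D : (Fin m → F) → Fin r → F) (B : Finset (Fin m → F)),
      m * R ≤ r * Real.logb 2 (Fintype.card F) ∧ (∀ w, ∀ z ∉ B, D (G w + z) = w) ∧
      ∑ z : Fin m → F, (∏ i, p (z i)) * (if z ∈ B then 1 else 0) ≤ ε := by
  set q : ℝ := (Fintype.card F : ℝ) with hq
  have hq1 : 1 < q := by rw [hq]; exact_mod_cast Fintype.one_lt_card
  set ℓ := Real.logb 2 q with hℓ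
  have hℓ0 : 0 < ℓ := Real.logb_pos (by norm_num) hq1
  have h2ℓ : (2 : ℝ) ^ ℓ = q := Real.rpow_logb (by norm_num) (by norm_num) (by linarith)
  -- With half the gap spent on typicality, the union bound over codewords still decays like `2 ^
  -- (-(m * δ))`; rounding `r` up costs at most one factor `q`.
  set δ := (ℓ - entropyBits p - R) / 2 with hδ
  have hδ0 : 0 < δ := by rw [hδ]; linarith
  obtain ⟨M₁, hM₁⟩ := exists_typical_set hp0 hp hδ0 (half_pos hε)
  obtain ⟨M₂, hM₂⟩ : ∃ M₂ : ℕ, ∀ m : ℕ, M₂ ≤ m → q * (2 : ℝ) ^ (-(m * δ)) ≤ ε / 2 := by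
    have ht : Filter.Tendsto (fun m : ℕ => q * ((2 : ℝ) ^ (-δ)) ^ m) Filter.atTop (nhds (q * 0)) :=
      (tendsto_pow_atTop_nhds_zero_of_lt_one (by positivity)
        (Real.rpow_lt_one_of_one_lt_of_neg (by norm_num) (by linarith))).const_mul q
    rw [mul_zero] at ht
    obtain ⟨M₂, h⟩ := Filter.eventually_atTop.1 (ht.eventually (ge_mem_nhds (half_pos hε)))
    refine ⟨M₂, fun m hm => ?_⟩
    have := h m hm
    rwa [← Real.rpow_natCast, ← Real.rpow_mul (by norm_num),
      show -δ * (m : ℝ) = -(m * δ) by ring] at this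
  refine ⟨max M₁ M₂, fun m hm => ?_⟩
  obtain ⟨T, hT1, hT2⟩ := hM₁ m (le_trans (le_max_left _ _) hm)
  have hM := hM₂ m (le_trans (le_max_right _ _) hm)
  set r := ⌈m * R / ℓ⌉₊ with hr
  obtain ⟨G, D, B, hD, hB⟩ := exists_linear_code_of_set r (fun z : Fin m → F => ∏ i, p (z i))
    (fun z => prod_nonneg fun i _ => hp0 _) (sum_prod_eq_one hp) T
  refine ⟨r, G, D, B, ?_, hD, ?_⟩
  · rw [← div_le_iff₀ hℓ0]
    exact Nat.le_ceil _
  · have hr2 : (r : ℝ) * ℓ ≤ m * R + ℓ := by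
      have : (r : ℝ) < m * R / ℓ + 1 := Nat.ceil_lt_add_one (by positivity)
      have h := mul_le_mul_of_nonneg_right this.le hℓ0.le
      rwa [add_mul, div_mul_cancel₀ _ hℓ0.ne', one_mul] at h
    have hqpow : ∀ k : ℕ, q ^ k = (2 : ℝ) ^ ((k : ℝ) * ℓ) := by
      intro k
      rw [mul_comm, Real.rpow_mul (by norm_num), h2ℓ, Real.rpow_natCast]
    rw [← hq] at hB
    have h3 : (q ^ r - 1) * (T.card / q ^ m) ≤ q * (2 : ℝ) ^ (-(m * δ)) := by
      calc (q ^ r - 1) * (T.card / q ^ m)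
          ≤ q ^ r * ((2 : ℝ) ^ ((m : ℝ) * (entropyBits p + δ)) / q ^ m) := by
            gcongr
            linarith
        _ = (2 : ℝ) ^ (r * ℓ + m * (entropyBits p + δ) - m * ℓ) := by
            rw [hqpow, hqpow, Real.rpow_sub (by norm_num), Real.rpow_add (by norm_num)]
            ring
        _ ≤ (2 : ℝ) ^ (ℓ + -(m * δ)) := by
            apply Real.rpow_le_rpow_of_exponent_le (by norm_num)
            have : (m : ℝ) * (2 * δ) = m * (ℓ - entropyBits p - R) := by rw [hδ]; ring
            nlinarith
        _ = q * (2 : ℝ) ^ (-(m * δ)) := by rw [Real.rpow_add (by norm_num), h2ℓ]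
    refine hB.trans (le_trans (add_le_add ?_ (h3.trans hM)) (add_halves ε).le)
    refine (sum_congr rfl fun z _ => ?_).trans_le hT2
    congr

end LinearCode

/-! ### Visits to the channel states -/

section Scheme

variable {C : Type*} {n : ℕ}

/-- The half of the block of `n` slots in which `t` lies. -/
def lateHalf (n : ℕ) (t : Fin n) : Bool := decide (n / 2 ≤ t.val)

/-- Slot `s` is in half `b`, and the channel is in state `A` there. -/
def IsVisit (H : Fin n → C) (b : Bool) (A : C) (s : ℕ) : Prop :=
  ∃ h : s < n, lateHalf n ⟨s, h⟩ = b ∧ H ⟨s, h⟩ = A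

open Classical in
/-- The number of visits to state `A` in half `b` before time `t`. -/
noncomputable def visits (H : Fin n → C) (b : Bool) (A : C) (t : ℕ) : ℕ :=
  Nat.count (IsVisit H b A) t

/-- This is what makes the encoder causal: the index of the symbol to be sent depends on past states
only. -/
theorem visits_congr {H H' : Fin n → C} {t : ℕ} (h : ∀ s : Fin n, s.val < t → H s = H' s)
    (b : Bool) (A : C) : visits H b A t = visits H' b A t := by
  classical
  unfold visits
  rw [Nat.count_eq_card_filter_range, Nat.count_eq_card_filter_range]
  congr 1
  refine filter_congr fun s hs => ?_
  unfold IsVisit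
  refine exists_congr fun hs' => ?_
  rw [h ⟨s, hs'⟩ (mem_range.1 hs)]

theorem visits_eq_card [DecidableEq C] (H : Fin n → C) (b : Bool) (A : C) :
    visits H b A n = #{t : Fin n | lateHalf n t = b ∧ H t = A} := by
  classical
  unfold visits
  rw [Nat.count_eq_card_filter_range]
  symm
  refine card_bij (fun t _ => t.val) ?_ ?_ ?_
  · intro t ht
    simp only [mem_filter, mem_univ, true_and] at ht
    exact mem_filter.2 ⟨mem_range.2 t.2, t.2, ht⟩
  · intro a _ b _ h
    exact Fin.ext h
  · intro s hs
    obtain ⟨h, h'⟩ := (mem_filter.1 hs).2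
    exact ⟨⟨s, h⟩, by simpa using h', rfl⟩

/-- The times of the first `m` visits. -/
theorem exists_visit_times {H : Fin n → C} {b : Bool} {A : C} {m : ℕ} (h : m ≤ visits H b A n) :
    ∃ τ : Fin m → Fin n, ∀ j, lateHalf n (τ j) = b ∧ H (τ j) = A ∧
      visits H b A (τ j) = j := by
  classical
  have hlt : ∀ j : Fin m, Nat.nth (IsVisit H b A) j < n := fun j =>
    Nat.nth_lt_of_lt_count (lt_of_lt_of_le j.2 h)
  -- There are finitely many visits, and `Nat.nth` takes a default value beyond the last one.
  have hc : ∀ j : Fin m, ∀ hf : (Set.ofPred (IsVisit H b A)).Finite, (j : ℕ) < #hf.toFinset :=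
    fun j hf => lt_of_lt_of_le (lt_of_lt_of_le j.2 h) (Nat.count_le_card hf n)
  refine ⟨fun j => ⟨Nat.nth (IsVisit H b A) j, hlt j⟩, fun j => ?_⟩
  obtain ⟨_, h1, h2⟩ := Nat.nth_mem _ (hc j)
  exact ⟨h1, h2, Nat.count_nth (hc j)⟩

/-- Every state is visited at least `m` times in each half. -/
def VisitsAll (m : ℕ) (H : Fin n → C) : Prop := ∀ b A, m ≤ visits H b A n

/-- The times depend on the states alone, hence not on the noise; the decoder and its analysis use
the same choice. -/
theorem VisitsAll.exists_times {m : ℕ} {H : Fin n → C} (h : VisitsAll m H) :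
    ∃ τ : Bool → C → Fin m → Fin n, ∀ b A j, lateHalf n (τ b A j) = b ∧ H (τ b A j) = A ∧
      visits H b A (τ b A j) = j := by
  choose τ hτ using fun b A => exists_visit_times (h b A)
  exact ⟨τ, hτ⟩

end Scheme

/-! ### Alignment of interference and the coding scheme -/

section Alignment

variable {F : Type*} [Field F] {K : ℕ}

/-- Each state `A` is matched to the states `σ b A`, one in each half `b`, and transmitter `l` is
scaled by `c l b` in half `b`. Receiver `k` recovers what transmitter `k` sends by weighting the two
received combinations with `d k A b`, which cancels the interference. -/
structure Alignment (F : Type*) [Field F] (K : ℕ) where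
  σ : Bool → Equiv.Perm (ChannelMatrix F K)
  c : Fin K → Bool → F
  d : Fin K → ChannelMatrix F K → Bool → F
  cancel : ∀ k l A, ∑ b, d k A b * ((σ b A k l : F) * c l b) = if l = k then 1 else 0

/-- Ergodic alignment: the diagonal coefficients change and the others do not. -/
theorem Alignment.nonempty_of_two_lt_card [Fintype F] (hF : 2 < Fintype.card F) :
    Nonempty (Alignment F K) := by
  classical
  obtain ⟨u, hu⟩ : ∃ u : Fˣ, u ≠ 1 := by
    have : 1 < Fintype.card Fˣ := by rw [Fintype.card_units]; omega
    exact Fintype.exists_ne_of_one_lt_card this 1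
  have hu' : (1 : F) - u ≠ 0 := by
    rw [sub_ne_zero]
    exact fun h => hu (Units.ext h.symm)
  let s : Equiv.Perm (ChannelMatrix F K) :=
    { toFun := fun A k l => (if l = k then u else 1) * A k l
      invFun := fun A k l => (if l = k then u else 1)⁻¹ * A k l
      left_inv := fun A => by funext k l; exact inv_mul_cancel_left _ _
      right_inv := fun A => by funext k l; exact mul_inv_cancel_left _ _ }
  -- Off the diagonal the two halves cancel by sign; on it the difference is (1 - u) `A k k`, which
  -- the weight inverts.
  refine ⟨⟨fun b => if b then s else 1, fun _ _ => 1,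
    fun k A b => (if b then -1 else 1) * ((1 - (u : F)) * (A k k : F))⁻¹, ?_⟩⟩
  intro k l A
  have hA : (A k k : F) ≠ 0 := (A k k).ne_zero
  by_cases h : l = k
  · subst h
    simp [s]
    field_simp
    ring
  · simp [s, h]

/-- Time sharing between two users. -/
theorem Alignment.nonempty_of_le_two (hK : K ≤ 2) : Nonempty (Alignment F K) := by
  classical
  -- User 1 is active only in the late half and user 0 only in the early one, so no two users are
  -- ever active together.
  refine ⟨⟨fun _ => 1, fun l b => if b = decide (l.val = 1) then 1 else 0,
    fun k A b => if b = decide (k.val = 1) then (A k k : F)⁻¹ else 0, ?_⟩⟩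
  intro k l A
  have hA : (A k k : F) ≠ 0 := (A k k).ne_zero
  have hk := k.2
  have hl := l.2
  by_cases h : l = k
  · subst h
    simp [hA]
  · have hne : ¬ (l.val = 1 ↔ k.val = 1) := by
      have : l.val ≠ k.val := fun h' => h (Fin.ext h')
      omega
    simp [h, hne]

open Classical in
/-- The code that uses a linear code separately for each state and each half. It succeeds as soon as
all states are visited often enough and none of the linear codes meets an exceptional noise
sequence. -/
theorem Alignment.exists_code [Fintype F] [DecidableEq F] (a : Alignment F K) (n : ℕ) {m r : ℕ}
    (G : (Fin r → F) →ₗ[F] (Fin m → F)) (D : (Fin m → F) → Fin r → F) (B : Finset (Fin m → F))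
    (hD : ∀ w, ∀ z ∉ B, D (G w + z) = w) :
    ∃ code : Code F K n,
      (∀ k, code.size k = Fintype.card (ChannelMatrix F K → Fin r → F)) ∧
      ∀ H : Fin n → ChannelMatrix F K, VisitsAll m H →
        ∃ τ : Bool → ChannelMatrix F K → Fin m → Fin n, (∀ b A, Function.Injective (τ b A)) ∧
          ∀ w Z, (∀ k b A, (fun j => Z (τ b A j) k) ∉ B) → ¬ code.Fails w H Z := by
  let e := Fintype.equivFin (ChannelMatrix F K → Fin r → F)
  let code : Code F K n :=
    { size := fun _ => Fintype.card (ChannelMatrix F K → Fin r → F)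
      size_pos := fun _ => Fintype.card_pos
      -- The block of `A` is sent at visits to `a.σ b A`, hence the inverse permutation here. After
      -- `m` visits the transmitter is silent.
      enc := fun k w H t =>
        if h : visits H (lateHalf n t) (H t) t < m then
          a.c k (lateHalf n t) * G (e.symm w ((a.σ (lateHalf n t)).symm (H t))) ⟨_, h⟩
        else 0
      enc_causal := by
        intro k w H H' t hH
        have h1 := visits_congr (t := t.val) (fun s hs => hH s (le_of_lt hs)) (lateHalf n t) (H t)
        simp only [← hH t le_rfl, h1]
      -- Each half is decoded before the weights are applied, so that the noises of the two halves
      -- are never added.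
      dec := fun k y H => if h : VisitsAll m H then
          e fun A => ∑ b, a.d k A b • D fun j => y (h.exists_times.choose b (a.σ b A) j)
        else ⟨0, Fintype.card_pos⟩ }
  refine ⟨code, fun _ => rfl, fun H hH => ?_⟩
  have hτ := hH.exists_times.choose_spec
  set τ := hH.exists_times.choose with hτdef
  refine ⟨τ, fun b A i j hij => ?_, fun w Z hZ => ?_⟩
  · have h1 := (hτ b A i).2.2
    rw [hij, (hτ b A j).2.2] at h1
    exact Fin.ext h1.symm
  · rintro ⟨k, hk⟩
    apply hk
    -- Along these visits the channel is constant, so by linearity the superposed codewords form the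
    -- codeword of one combination of messages.
    have hout : ∀ A b, (fun j => code.output w H Z k (τ b (a.σ b A) j)) =
        G (∑ l, ((a.σ b A k l : F) * a.c l b) • e.symm (w l) A) +
          fun j => Z (τ b (a.σ b A) j) k := by
      intro A b
      funext j
      obtain ⟨h1, h2, h3⟩ := hτ b (a.σ b A) j
      simp only [Code.output, Pi.add_apply, map_sum, map_smul, Finset.sum_apply, Pi.smul_apply,
        smul_eq_mul]
      congr 1
      refine sum_congr rfl fun l _ => ?_
      simp only [code, h1, h2, h3, j.2, dif_pos, Equiv.symm_apply_apply, mul_assoc]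
    change (if h : VisitsAll m H then _ else _) = _
    rw [dif_pos hH, ← Equiv.eq_symm_apply]
    funext A
    change ∑ b, a.d k A b • D (fun j => code.output w H Z k (τ b (a.σ b A) j)) = _
    simp_rw [hout A, hD _ _ (hZ k _ _), smul_sum, smul_smul]
    rw [sum_comm]
    simp_rw [← sum_smul, a.cancel]
    simp

end Alignment

/-! ### Concentration of the visit counts -/

theorem card_le_two_mul_card_half (n : ℕ) (b : Bool) :
    n ≤ 2 * #{t : Fin n | lateHalf n t = b} + 1 := by
  -- For odd `n` the early half is the shorter one, which accounts for the additive 1.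
  have h1 : #{t : Fin n | lateHalf n t = false} = n / 2 := by
    have : (univ.filter fun t : Fin n => lateHalf n t = false) =
        univ.filter fun t : Fin n => t.val < n / 2 := by
      ext t
      simp [lateHalf]
    rw [this, Fin.card_filter_val_lt]
    omega
  have h2 := card_filter_add_card_filter_not (s := (univ : Finset (Fin n)))
    (fun t => lateHalf n t = false)
  simp only [Bool.not_eq_false, card_univ, Fintype.card_fin] at h2
  cases b <;> omega

open Classical in
/-- With high probability, every state is visited nearly as often as expected in each half. -/
theorem exists_visitsAll_bound {C : Type*} [Fintype C] [Nonempty C] {α : ℝ}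
    (hα : α < 1 / (2 * Fintype.card C)) {ε : ℝ} (hε : 0 < ε) :
    ∃ M : ℕ, ∀ n : ℕ, M ≤ n → ∀ m : ℕ, (m : ℝ) ≤ α * n + 1 →
      ∑ H : Fin n → C, (∏ _t : Fin n, (1 / Fintype.card C : ℝ)) *
        (if VisitsAll m H then 0 else 1) ≤ ε := by
  set N : ℝ := (Fintype.card C : ℝ) with hN
  have hN1 : 1 ≤ N := by rw [hN]; exact_mod_cast Nat.one_le_iff_ne_zero.2 Fintype.card_ne_zero
  have hN0 : 0 < N := by linarith
  -- The expected count exceeds `α * n` by about `2 * κ * n`. One `κ * n` is the deviation in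
  -- Chebyshev's inequality; the other, at least 2, absorbs the rounding of `m` and the odd slot.
  set κ := (1 / (2 * N) - α) / 2 with hκ
  have hκ0 : 0 < κ := by rw [hκ]; linarith
  refine ⟨⌈2 / κ⌉₊ + ⌈2 * N / (κ ^ 2 * ε)⌉₊ + 1, fun n hn m hm => ?_⟩
  have hn0 : (0 : ℝ) < n := by exact_mod_cast (by omega : 0 < n)
  have hn1 : 2 ≤ κ * n := by
    have : 2 / κ ≤ n := (Nat.le_ceil _).trans (by exact_mod_cast (by omega))
    rwa [div_le_iff₀' hκ0] at this
  have hn2 : 2 * N / (κ ^ 2 * ε) ≤ n := (Nat.le_ceil _).trans (by exact_mod_cast (by omega))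
  rw [div_le_iff₀ (by positivity)] at hn2
  let p : C → ℝ := fun _ => 1 / N
  have hp0 : ∀ a, 0 ≤ p a := fun a => by positivity
  have hp : ∑ a, p a = 1 := by
    simp only [p, sum_const, card_univ, nsmul_eq_mul, ← hN]
    field_simp
  -- Centred indicator of a visit, set to zero in the other half.
  let f : Bool → C → Fin n → C → ℝ := fun b A t a =>
    if lateHalf n t = b then (if a = A then 1 else 0) - 1 / N else 0
  have hf : ∀ b A t, ∑ a, p a * f b A t a = 0 := by
    intro b A t
    by_cases h : lateHalf n t = b
    · simp only [f, h, if_true, mul_sub, sum_sub_distrib, ← sum_mul, hp]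
      simp [p]
    · simp [f, h]
  have hf2 : ∀ b A, ∑ t, ∑ a, p a * f b A t a ^ 2 ≤ n := by
    intro b A
    calc ∑ t, ∑ a, p a * f b A t a ^ 2 ≤ ∑ t : Fin n, ∑ a, p a * 1 := by
          refine sum_le_sum fun t _ => sum_le_sum fun a _ =>
            mul_le_mul_of_nonneg_left ?_ (hp0 a)
          have h1 : 1 / N ≤ 1 := by rw [div_le_one hN0]; exact hN1
          have h2 : 0 < 1 / N := by positivity
          simp only [f]
          split_ifs <;> nlinarith
      _ = n := by simp [hp]
  have hsum : ∀ b A (H : Fin n → C), ∑ t, f b A t (H t) =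
      visits H b A n - #{t : Fin n | lateHalf n t = b} / N := by
    intro b A H
    simp only [f]
    rw [← sum_filter, sum_sub_distrib, sum_boole, filter_filter, visits_eq_card, sum_const,
      nsmul_eq_mul, mul_one_div]
  have hκn : 0 < κ * n := by positivity
  have hbad : ∀ b A (H : Fin n → C), visits H b A n < m → κ * n ≤ |∑ t, f b A t (H t)| := by
    intro b A H h
    rw [hsum]
    refine le_trans ?_ (neg_le_abs _)
    have h1 : (visits H b A n : ℝ) ≤ m := by exact_mod_cast h.le
    have h2 : (n : ℝ) ≤ 2 * #{t : Fin n | lateHalf n t = b} + 1 := by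
      exact_mod_cast card_le_two_mul_card_half n b
    have h3 : ((n : ℝ) - 1) / 2 / N ≤ #{t : Fin n | lateHalf n t = b} / N := by
      gcongr
      linarith
    have h4 : ((n : ℝ) - 1) / 2 / N = n * (1 / (2 * N)) - 1 / (2 * N) := by
      field_simp
    have h5 : 1 / (2 * N) ≤ 1 := by
      rw [div_le_one (by positivity)]
      linarith
    have h6 : (n : ℝ) * (1 / (2 * N)) = 2 * (κ * n) + α * n := by
      rw [hκ]
      ring
    linarith
  calc ∑ H : Fin n → C, (∏ _t : Fin n, (1 / N)) * (if VisitsAll m H then (0 : ℝ) else 1)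
      ≤ ∑ H : Fin n → C, ∑ b, ∑ A, (∏ t, p (H t)) *
          (if κ * n ≤ |∑ t, f b A t (H t)| then 1 else 0) := by
        refine sum_le_sum fun H _ => ?_
        simp_rw [← mul_sum]
        refine mul_le_mul_of_nonneg_left ?_ (prod_nonneg fun t _ => hp0 (H t))
        have hnn : ∀ b A, 0 ≤ (if κ * n ≤ |∑ t, f b A t (H t)| then (1 : ℝ) else 0) :=
          fun b A => by positivity
        by_cases h : VisitsAll m H
        · rw [if_pos h]
          exact sum_nonneg fun b _ => sum_nonneg fun A _ => hnn b A
        · rw [if_neg h]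
          simp only [VisitsAll, not_forall, not_le] at h
          obtain ⟨b, A, h⟩ := h
          calc (1 : ℝ) = if κ * n ≤ |∑ t, f b A t (H t)| then (1 : ℝ) else 0 := by
                rw [if_pos (hbad b A H h)]
            _ ≤ ∑ A, (if κ * n ≤ |∑ t, f b A t (H t)| then (1 : ℝ) else 0) :=
                single_le_sum (f := fun A => if κ * n ≤ |∑ t, f b A t (H t)| then (1 : ℝ) else 0)
                  (fun A _ => hnn b A) (mem_univ A)
            _ ≤ _ := single_le_sum
                  (f := fun b => ∑ A, if κ * n ≤ |∑ t, f b A t (H t)| then (1 : ℝ) else 0)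
                  (fun b _ => sum_nonneg fun A _ => hnn b A) (mem_univ b)
    _ = ∑ b, ∑ A, ∑ H : Fin n → C, (∏ t, p (H t)) *
          (if κ * n ≤ |∑ t, f b A t (H t)| then 1 else 0) := by
        rw [sum_comm]
        exact sum_congr rfl fun b _ => sum_comm
    _ ≤ ∑ b : Bool, ∑ A : C, n / (κ * n) ^ 2 := by
        refine sum_le_sum fun b _ => sum_le_sum fun A _ => ?_
        refine (sum_prod_chebyshev hp0 hp (f b A) (hf b A) hκn).trans ?_
        gcongr
        exact hf2 b A
    _ ≤ ε := by
        simp only [sum_const, card_univ, nsmul_eq_mul, Fintype.card_bool, ← hN]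
        have : (n : ℝ) / (κ * n) ^ 2 = 1 / (κ ^ 2 * n) := by field_simp
        rw [this]
        push_cast
        rw [← mul_assoc, mul_one_div, div_le_iff₀ (by positivity)]
        linarith

/-! ### Error probability and achievability -/

section Noise

variable {F : Type*} [Field F] [Fintype F] [DecidableEq F] {ρ : ℝ}

theorem noiseProb_nonneg (hρ0 : 0 ≤ ρ) (hρ1 : ρ ≤ 1) (z : F) : 0 ≤ noiseProb F ρ z := by
  have : (1 : ℝ) < Fintype.card F := by exact_mod_cast Fintype.one_lt_card
  unfold noiseProb
  split_ifs
  · linarith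
  · exact div_nonneg hρ0 (by linarith)

theorem sum_noiseProb (ρ : ℝ) : ∑ z : F, noiseProb F ρ z = 1 := by
  have h1 : (1 : ℝ) < Fintype.card F := by exact_mod_cast Fintype.one_lt_card
  rw [← add_sum_erase univ _ (mem_univ (0 : F))]
  have : ∀ z ∈ univ.erase (0 : F), noiseProb F ρ z = ρ / ((Fintype.card F : ℝ) - 1) := fun z hz => by
    simp [noiseProb, (mem_erase.1 hz).1]
  rw [sum_congr rfl this, sum_const, card_erase_of_mem (mem_univ _), card_univ, nsmul_eq_mul,
    Nat.cast_sub Fintype.card_pos]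
  have h2 : (Fintype.card F : ℝ) - 1 ≠ 0 := by linarith
  simp only [noiseProb, if_true, Nat.cast_one]
  field_simp
  ring

open Classical in
/-- If a code fails only when some state is visited too rarely or some of the noise sequences along
the visits is exceptional, then a union bound controls its error probability. -/
theorem errorProb_le {K n m : ℕ} (code : Code F K n) (hρ0 : 0 ≤ ρ) (hρ1 : ρ ≤ 1)
    (B : Finset (Fin m → F)) {ε₁ ε₂ : ℝ}
    (hcode : ∀ H : Fin n → ChannelMatrix F K, VisitsAll m H →
      ∃ τ : Bool → ChannelMatrix F K → Fin m → Fin n, (∀ b A, Function.Injective (τ b A)) ∧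
        ∀ w Z, (∀ k b A, (fun j => Z (τ b A j) k) ∉ B) → ¬ code.Fails w H Z)
    (hH : ∑ H : Fin n → ChannelMatrix F K,
      (∏ _t : Fin n, (1 / Fintype.card (ChannelMatrix F K) : ℝ)) *
        (if VisitsAll m H then 0 else 1) ≤ ε₁)
    (hB : ∑ z : Fin m → F, (∏ i, noiseProb F ρ (z i)) * (if z ∈ B then 1 else 0) ≤ ε₂) :
    code.errorProb ρ ≤ ε₁ + K * (2 * (Fintype.card (ChannelMatrix F K) * ε₂)) := by
  set N : ℝ := (Fintype.card (ChannelMatrix F K) : ℝ) with hN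
  have hp0 := noiseProb_nonneg (F := F) hρ0 hρ1
  have hp := sum_noiseProb (F := F) ρ
  have hPZ0 : ∀ Z : Fin n → Fin K → F, 0 ≤ ∏ t, ∏ k, noiseProb F ρ (Z t k) := fun Z =>
    prod_nonneg fun t _ => prod_nonneg fun k _ => hp0 _
  have hPZ : ∑ Z : Fin n → Fin K → F, ∏ t, ∏ k, noiseProb F ρ (Z t k) = 1 :=
    sum_prod_eq_one (p := fun z : Fin K → F => ∏ k, noiseProb F ρ (z k)) (sum_prod_eq_one hp)
  have hPH : (∏ _t : Fin n, ∏ _k : Fin K, ∏ _l : Fin K, (1 / (Fintype.card Fˣ : ℝ))) =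
      ∏ _t : Fin n, (1 / N) := by
    refine prod_congr rfl fun _ _ => ?_
    simp [hN]
  have hN0 : 0 < N := by rw [hN]; exact_mod_cast Fintype.card_pos
  have hPH1 : ∑ _H : Fin n → ChannelMatrix F K, ∏ _t : Fin n, (1 / N) = 1 := by
    refine sum_prod_eq_one (p := fun _ : ChannelMatrix F K => 1 / N) ?_
    rw [sum_const, card_univ, nsmul_eq_mul, ← hN]
    field_simp
  have hinner : ∀ w H, ∑ Z : Fin n → Fin K → F, (∏ t, ∏ k, noiseProb F ρ (Z t k)) *
      (if code.Fails w H Z then 1 else 0) ≤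
      (if VisitsAll m H then 0 else 1) + K * (2 * (N * ε₂)) := by
    intro w H
    have hε₂ : 0 ≤ ε₂ := le_trans (sum_nonneg fun z _ =>
      mul_nonneg (prod_nonneg fun i _ => hp0 _) (by positivity)) hB
    by_cases h : VisitsAll m H
    · obtain ⟨τ, hτ, hfail⟩ := hcode H h
      rw [if_pos h, zero_add]
      calc ∑ Z : Fin n → Fin K → F, (∏ t, ∏ k, noiseProb F ρ (Z t k)) *
            (if code.Fails w H Z then (1 : ℝ) else 0)
          ≤ ∑ Z : Fin n → Fin K → F, ∑ k, ∑ b, ∑ A, (∏ t, ∏ k, noiseProb F ρ (Z t k)) *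
            (if (fun j => Z (τ b A j) k) ∈ B then 1 else 0) := by
            refine sum_le_sum fun Z _ => ?_
            simp_rw [← mul_sum]
            refine mul_le_mul_of_nonneg_left ?_ (hPZ0 Z)
            let I : Fin K → Bool → ChannelMatrix F K → ℝ := fun k b A =>
              if (fun j => Z (τ b A j) k) ∈ B then 1 else 0
            have hnn : ∀ k b A, 0 ≤ I k b A := fun k b A => by
              simp only [I]
              positivity
            change _ ≤ ∑ k, ∑ b, ∑ A, I k b A
            split_ifs with hF
            · have : ∃ k b A, (fun j => Z (τ b A j) k) ∈ B := by
                by_contra! hno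
                exact hfail w Z hno hF
              obtain ⟨k, b, A, hkbA⟩ := this
              calc (1 : ℝ) = I k b A := by simp only [I]; rw [if_pos hkbA]
                _ ≤ ∑ A, I k b A := single_le_sum (fun A _ => hnn k b A) (mem_univ A)
                _ ≤ ∑ b, ∑ A, I k b A := single_le_sum (f := fun b => ∑ A, I k b A)
                    (fun b _ => sum_nonneg fun A _ => hnn k b A) (mem_univ b)
                _ ≤ _ := single_le_sum (f := fun k => ∑ b, ∑ A, I k b A)
                    (fun k _ => sum_nonneg fun b _ => sum_nonneg fun A _ => hnn k b A)
                    (mem_univ k)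
            · exact sum_nonneg fun k _ => sum_nonneg fun b _ => sum_nonneg fun A _ => hnn k b A
        _ = ∑ k, ∑ b, ∑ A, ∑ Z : Fin n → Fin K → F, (∏ t, ∏ k, noiseProb F ρ (Z t k)) *
            (if (fun j => Z (τ b A j) k) ∈ B then 1 else 0) := by
            rw [sum_comm]
            refine sum_congr rfl fun k _ => ?_
            rw [sum_comm]
            exact sum_congr rfl fun b _ => sum_comm
        _ ≤ ∑ _k : Fin K, ∑ _b : Bool, ∑ _A : ChannelMatrix F K, ε₂ := by
            refine sum_le_sum fun k _ => sum_le_sum fun b _ => sum_le_sum fun A _ => ?_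
            -- For fixed `H` the times `τ b A` are fixed, so the noise along them has the product
            -- law for which the code was built.
            rw [sum_prod_prod_mul_comp hp (hτ b A) k (fun z => if z ∈ B then 1 else 0)]
            exact hB
        _ = K * (2 * (N * ε₂)) := by
            simp only [sum_const, card_univ, nsmul_eq_mul, Fintype.card_bool, Fintype.card_fin,
              ← hN]
            push_cast
            ring
    · rw [if_neg h]
      have : ∑ Z : Fin n → Fin K → F, (∏ t, ∏ k, noiseProb F ρ (Z t k)) *
          (if code.Fails w H Z then 1 else 0) ≤ 1 := by
        refine (sum_le_sum fun Z _ => mul_le_of_le_one_right (hPZ0 Z) ?_).trans hPZ.le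
        split_ifs <;> norm_num
      have h2 : 0 ≤ K * (2 * (N * ε₂)) := by positivity
      linarith
  have houter : ∀ w, ∑ H : Fin n → ChannelMatrix F K, (∏ _t : Fin n, (1 / N)) *
      ∑ Z : Fin n → Fin K → F, (∏ t, ∏ k, noiseProb F ρ (Z t k)) *
        (if code.Fails w H Z then 1 else 0) ≤ ε₁ + K * (2 * (N * ε₂)) := by
    intro w
    refine (sum_le_sum fun H _ => mul_le_mul_of_nonneg_left (hinner w H)
      (prod_nonneg fun _ _ => by positivity)).trans ?_
    simp_rw [mul_add]
    rw [sum_add_distrib]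
    refine add_le_add hH ?_
    rw [← sum_mul, hPH1, one_mul]
  have hPw : ∑ _w : (k : Fin K) → Fin (code.size k), ∏ k, (1 / (code.size k : ℝ)) = 1 := by
    rw [sum_const, card_univ, nsmul_eq_mul, Fintype.card_pi]
    push_cast
    rw [← prod_mul_distrib]
    refine prod_eq_one fun k _ => ?_
    have : (code.size k : ℝ) ≠ 0 := by exact_mod_cast (code.size_pos k).ne'
    simp [this]
  unfold Code.errorProb
  rw [hPH]
  calc _ = ∑ w : (k : Fin K) → Fin (code.size k), (∏ k, (1 / (code.size k : ℝ))) *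
        ∑ H : Fin n → ChannelMatrix F K, (∏ _t : Fin n, (1 / N)) *
          ∑ Z : Fin n → Fin K → F, (∏ t, ∏ k, noiseProb F ρ (Z t k)) *
            (if code.Fails w H Z then 1 else 0) := by
        simp only [mul_sum, mul_assoc]
    _ ≤ ∑ _w : (k : Fin K) → Fin (code.size k), (∏ k, (1 / (code.size k : ℝ))) *
        (ε₁ + K * (2 * (N * ε₂))) :=
        sum_le_sum fun w _ => mul_le_mul_of_nonneg_left (houter w)
          (prod_nonneg fun _ _ => by positivity)
    _ = _ := by rw [← sum_mul, hPw, one_mul]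

/-- A code with one message per user. -/
theorem exists_trivial_code (K n : ℕ) (ρ : ℝ) :
    ∃ c : Code F K n, (∀ k, c.rate k = 0) ∧ c.errorProb ρ = 0 := by
  refine ⟨⟨fun _ => 1, fun _ => one_pos, fun _ _ _ _ => 0, fun _ _ _ _ _ _ => rfl,
    fun _ _ _ => 0⟩, fun k => by simp [Code.rate], ?_⟩
  unfold Code.errorProb
  refine sum_eq_zero fun w _ => sum_eq_zero fun H _ => sum_eq_zero fun Z _ => ?_
  rw [if_neg, mul_zero]
  rintro ⟨k, hk⟩
  exact hk (Subsingleton.elim (α := Fin 1) _ _)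

/-- Each of the N states carries a code of length about n / (2N) and rate near log q - H(Z), which
adds up to half that rate per channel use. -/
theorem Alignment.achievable {K : ℕ} (a : Alignment F K) (hρ0 : 0 ≤ ρ) (hρ1 : ρ ≤ 1) :
    Achievable F K ρ fun _ =>
      (1 / 2 : ℝ) * (Real.logb 2 (Fintype.card F : ℝ) - entropyBits (noiseProb F ρ)) := by
  classical
  intro ε hε
  set ℓ := Real.logb 2 (Fintype.card F : ℝ) with hℓ
  set C₀ := ℓ - entropyBits (noiseProb F ρ) with hC₀
  -- A negative target needs no coding; otherwise `C₀ ≥ 2 * ε` and the rate `R` below is positive.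
  rcases lt_or_ge ((1 / 2) * C₀ - ε) 0 with hneg | hnn
  · refine ⟨0, fun n _ => ?_⟩
    obtain ⟨c, hc, he⟩ := exists_trivial_code (F := F) K n ρ
    exact ⟨c, fun k => by rw [hc]; exact hneg, by rw [he]; exact hε⟩
  set N : ℝ := (Fintype.card (ChannelMatrix F K) : ℝ) with hN
  have hN0 : 0 < N := by rw [hN]; exact_mod_cast Fintype.card_pos
  set R := C₀ - ε / 2 with hR
  have hR0 : 0 < R := by linarith
  -- The upper bound lets the visit counts reach `α * n`; the lower one makes the total rate `N * α
  -- * R` exceed the target. There is room because `R / 2` is `C₀ / 2 - ε / 4`.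
  obtain ⟨α, hα1, hα2⟩ : ∃ α, ((1 / 2) * C₀ - ε) / (N * R) < α ∧ α < 1 / (2 * N) := by
    apply _root_.exists_between
    rw [div_lt_div_iff₀ (by positivity) (by positivity)]
    nlinarith
  have hα0 : 0 < α := lt_of_le_of_lt (by positivity) hα1
  rw [div_lt_iff₀ (by positivity)] at hα1
  -- The union bound has `K * (2 * N)` terms; the extra 1 makes their total strictly less than `ε /
  -- 2` and keeps the denominator positive when `K = 0`.
  set η := ε / (2 * (K * (2 * N) + 1)) with hη
  have hη0 : 0 < η := by positivity
  obtain ⟨M₁, hM₁⟩ := exists_linear_code (noiseProb_nonneg (F := F) hρ0 hρ1) (sum_noiseProb ρ)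
    hR0.le (by linarith) hη0
  obtain ⟨M₂, hM₂⟩ := exists_visitsAll_bound (C := ChannelMatrix F K) hα2 (half_pos hε)
  refine ⟨⌈M₁ / α⌉₊ + M₂ + 1, fun n hn => ?_⟩
  have hn0 : (0 : ℝ) < n := by exact_mod_cast (by omega : 0 < n)
  set m := ⌈α * n⌉₊ with hm
  have hmn : α * n ≤ m := Nat.le_ceil _
  have hmM : M₁ ≤ m := by
    have h1 : M₁ / α ≤ n := (Nat.le_ceil _).trans (by exact_mod_cast (by omega))
    rw [div_le_iff₀' hα0] at h1
    exact_mod_cast h1.trans hmn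
  obtain ⟨r, G, D, B, hr, hD, hB⟩ := hM₁ m hmM
  obtain ⟨c, hsize, hc⟩ := a.exists_code n G D B hD
  refine ⟨c, fun k => ?_, ?_⟩
  · have h1 : (c.size k : ℝ) = ((Fintype.card F : ℝ) ^ r) ^ Fintype.card (ChannelMatrix F K) := by
      rw [hsize, Fintype.card_fun, Fintype.card_fun, Fintype.card_fin]
      push_cast
      rfl
    rw [Code.rate, h1, Real.logb_pow, Real.logb_pow, lt_div_iff₀ hn0, ← hN, ← hℓ]
    calc (1 / 2 * C₀ - ε) * n < α * (N * R) * n := by gcongr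
      _ = N * (α * n * R) := by ring
      _ ≤ N * (m * R) := by gcongr
      _ ≤ N * (r * ℓ) := by gcongr
  · have hle := errorProb_le c hρ0 hρ1 B hc
      (hM₂ n (by omega) m (Nat.ceil_lt_add_one (by positivity)).le) (by convert hB)
    refine hle.trans_lt ?_
    have : (K : ℝ) * (2 * (N * η)) < ε / 2 := by
      rw [hη]
      have hKN : 0 ≤ (K : ℝ) * (2 * N) := by positivity
      calc (K : ℝ) * (2 * (N * (ε / (2 * (K * (2 * N) + 1)))))
          = (K * (2 * N)) * ε / (2 * (K * (2 * N) + 1)) := by ring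
        _ < ε / 2 := by
          rw [div_lt_div_iff₀ (by positivity) (by positivity)]
          nlinarith
    linarith

end Noise

end ErgodicIC

theorem theorem1 (F : Type*) [Field F] [Fintype F] [DecidableEq F] (K : ℕ)
    (hK : 2 < Fintype.card F ∨ K ≤ 2) (ρ : ℝ) (hρ0 : 0 ≤ ρ) (hρ1 : ρ ≤ 1) :
    ErgodicIC.Achievable F K ρ (fun _ =>
      (1 / 2 : ℝ) * (Real.logb 2 (Fintype.card F : ℝ) -
        ErgodicIC.entropyBits (ErgodicIC.noiseProb F ρ))) := by
  obtain ⟨a⟩ : Nonempty (ErgodicIC.Alignment F K) :=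
    hK.elim ErgodicIC.Alignment.nonempty_of_two_lt_card ErgodicIC.Alignment.nonempty_of_le_two
  exact a.achievable hρ0 hρ1
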